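/- Let $(E,\mathcal F,\mu)$ be an arbitrary measure space, let $n\ge 0$, and let $\varphi_1,\dots,\varphi_{n+1}:E\to\mathbb C$ be orthonormal in $L^2(E,\mu)$. Put $$K_1(x,y)=\sum_{k=1}^{n}\varphi_k(x)\overline{\varphi_k(y)},\qquad K_2(x,y)=\sum_{k=1}^{n+1}\varphi_k(x)\overline{\varphi_k(y)}.$$ Let $\mathcal M(E)$ be the set of finite measures on $(E,\mathcal F)$ with values in the non-negative integers, with the $\sigma$-algebra generated by the maps $\theta\mapsto\theta(A)$, $A\in\mathcal F$, and with the partial order $\theta_1\le\theta_2$ iff $\theta_1(A)\le\theta_2(A)$ for all $A\in\mathcal F$. If $K$ is a projection kernel of rank $m$ as above, the determinantal point process with kernel $K$ is a random element of $\mathcal M(E)$ with the law of $\delta_{Z_1}+\dots+\delta_{Z_m}$, where $(Z_1,\dots,Z_m)$ is a random tuple in $E^m$ with density $\frac1{m!}\det(K(z_i,z_j))_{i,j\le m}$ with respect to $\mu^{\otimes m}$. (Here $\mu^{\otimes m}$ is the Carathéodory product measure, generated by measurable boxes; it is the usual product measure when $\mu$ is $\sigma$-finite.) (1) Let $\mathcal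 X_1$ and $\mathcal X_2$ be determinantal point processes with kernels $K_1$ and $K_2$. Then $\mathcal X_1$ is stochastically dominated by $\mathcal X_2$: for every measurable increasing (upward closed) set $\mathcal A\subseteq\mathcal M(E)$, $$\mathbf P\{\mathcal X_1\in\mathcal A\}\le\mathbf P\{\mathcal X_2\in\mathcal A\}.$$ (2) Let $X$ be a random vector in $E^n$ with density $\frac1{n!}|\det(\varphi_i(x_j))_{i,j\le n}|^2$ with respect to $\mu^{\otimes n}$, and $Y$ a random vector in $E^{n+1}$ with density $\frac1{(n+1)!}|\det(\varphi_i(y_j))_{i,j\le n+1}|^2$ with respect to $\mu^{\otimes(n+1)}$. Let $\mathcal A\subseteq E^n$ and $\mathcal B\subseteq E^{n+1}$ be measurable and symmetric (closed under permutations of the coordinates), and suppose that $\mathcal A\le\mathcal B$, i.e. $(x_1,\dots,x_n,t)\in\mathcal B$ for all $(x_1,\dots,x_n)\in\mathcal A$ and all $t\in E$. Then $$\mathbf P\{X\in\mathcal A\}\le\mathbf P\{Y\in\mathcal B\}.$$ -/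

import Mathlib

open MeasureTheory ProbabilityTheory
open scoped ComplexConjugate

/-- The space of point configurations on `E`: finite measures on `E` all of whose values on
measurable sets are non-negative integers. It carries the order `θ₁ ≤ θ₂ ↔ ∀ A, θ₁ A ≤ θ₂ A` and
the σ-algebra generated by the evaluations `θ ↦ θ A`, both inherited from `Measure E`. -/
abbrev PointConfiguration (E : Type*) [MeasurableSpace E] : Type _ :=
  {θ : Measure E // ∀ A : Set E, MeasurableSet A → ∃ k : ℕ, θ A = k}

/-- The point configuration `δ_{x₁} + ⋯ + δ_{xₙ}` of a tuple `x ∈ Eⁿ`. -/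
noncomputable def diracSum {E : Type*} [MeasurableSpace E] {n : ℕ} (x : Fin n → E) :
    PointConfiguration E :=
  ⟨∑ i, Measure.dirac (x i), fun A hA => by
    classical
    refine ⟨∑ i, if x i ∈ A then 1 else 0, ?_⟩
    rw [Measure.finsetSum_apply]
    push_cast
    refine Finset.sum_congr rfl fun i _ => ?_
    rw [Measure.dirac_apply' _ hA]
    by_cases h : x i ∈ A <;> simp [h]⟩

theorem measurable_diracSum {E : Type*} [MeasurableSpace E] {n : ℕ} :
    Measurable (diracSum : (Fin n → E) → PointConfiguration E) := by
  refine Measurable.subtype_mk (Measure.measurable_of_measurable_coe _ fun A hA => ?_)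
  simp only [Measure.finsetSum_apply, Measure.dirac_apply' _ hA]
  exact Finset.measurable_sum _ fun i _ =>
    (measurable_const.indicator hA).comp (measurable_pi_apply i)

/-- The kernel `K(x, y) = ∑ₖ φₖ(x) conj(φₖ(y))`. -/
noncomputable def projectionKernel {E : Type*} {n : ℕ} (φ : Fin n → E → ℂ) (x y : E) : ℂ :=
  ∑ k, φ k x * conj (φ k y)

/-- The measure on `Eⁿ` with density `(1 / n!) det (K(xᵢ, xⱼ))` with respect to `μ^{⊗ n}`.
(For the kernels `projectionKernel φ` the determinant is a non-negative real number.) -/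
noncomputable def kernelTupleLaw {E : Type*} [MeasurableSpace E] (μ : Measure E) (n : ℕ)
    (K : E → E → ℂ) : Measure (Fin n → E) :=
  (Measure.pi fun _ : Fin n => μ).withDensity fun x =>
    ENNReal.ofReal ((1 / (n.factorial : ℝ)) * (Matrix.det (Matrix.of fun i j => K (x i) (x j))).re)

/-- The measure on `Eⁿ` with density `(1 / n!) |det (φᵢ(xⱼ))|²` with respect to `μ^{⊗ n}`. -/
noncomputable def tupleLaw {E : Type*} [MeasurableSpace E] (μ : Measure E) {n : ℕ}
    (φ : Fin n → E → ℂ) : Measure (Fin n → E) :=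
  (Measure.pi fun _ : Fin n => μ).withDensity fun x =>
    ENNReal.ofReal ((1 / (n.factorial : ℝ)) * ‖Matrix.det (Matrix.of fun i j => φ i (x j))‖ ^ 2)

/-- `𝒳` is (in law) the `n`-point determinantal process on `(E, μ)` with kernel `K`, where `K` is a
projection kernel of rank `n`: its law is that of `δ_{X₁} + ⋯ + δ_{Xₙ}`, where `(X₁, …, Xₙ)` has
density `(1 / n!) det (K(xᵢ, xⱼ))` with respect to `μ^{⊗ n}`. -/
def IsDeterminantalProcess {E Ω : Type*} [MeasurableSpace E] [MeasurableSpace Ω]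
    (μ : Measure E) (n : ℕ) (K : E → E → ℂ) (𝒳 : Ω → PointConfiguration E)
    (P : Measure Ω) : Prop :=
  HasLaw 𝒳 ((kernelTupleLaw μ n K).map diracSum) P

/-- `𝒳` is stochastically dominated by `𝒴`: `P {𝒳 ∈ 𝒜} ≤ Q {𝒴 ∈ 𝒜}` for every measurable
increasing set `𝒜`. -/
def StochasticallyDominated {Ω₁ Ω₂ M : Type*} [MeasurableSpace Ω₁] [MeasurableSpace Ω₂]
    [MeasurableSpace M] [Preorder M] (𝒳 : Ω₁ → M) (P : Measure Ω₁) (𝒴 : Ω₂ → M)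
    (Q : Measure Ω₂) : Prop :=
  ∀ 𝒜 : Set M, MeasurableSet 𝒜 → IsUpperSet 𝒜 → P (𝒳 ⁻¹' 𝒜) ≤ Q (𝒴 ⁻¹' 𝒜)

/-- A set of tuples is symmetric if it is closed under permutations of the coordinates. -/
def IsSymmetricSet {E : Type*} {n : ℕ} (𝒜 : Set (Fin n → E)) : Prop :=
  ∀ σ : Equiv.Perm (Fin n), ∀ x ∈ 𝒜, x ∘ σ ∈ 𝒜

/-- The relation `𝒜 ≤ ℬ`: `(x₁, …, xₙ, t) ∈ ℬ` for all `(x₁, …, xₙ) ∈ 𝒜` and all `t ∈ E`. -/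
def TupleSetLE {E : Type*} {n : ℕ} (𝒜 : Set (Fin n → E)) (ℬ : Set (Fin (n + 1) → E)) : Prop :=
  ∀ x ∈ 𝒜, ∀ t : E, (Fin.snoc x t : Fin (n + 1) → E) ∈ ℬ

/-! Write ψ and D for the Slater determinants of the first n and of all n + 1 functions, u for the
last function, and f for ψ cut off to 𝒜. As 𝒜 is symmetric, f is still antisymmetric. The
antisymmetrization g of u ⊗ f (in essence u ∧ f) vanishes off ℬ, so testing D against g bounds the
mass of D on ℬ from below by Cauchy–Schwarz.

With a = ‖f‖², two facts are needed. First, ⟨g, D⟩ = (n+1)! (-1)ⁿ a, by cofactor expansion and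
orthonormality (`integral_conj_headTail_mul_slater`). Second, ‖g‖² ≤ (n+1)! n! a: wedging with a
unit vector is a contraction up to normalization (`integral_norm_antisymmetrization_headTail_le`),
because each transposition term subtracted from ‖u ⊗ f‖² is an integral of squared moduli
(`re_integral_headTail_swap_nonneg`). Together they give ∫_ℬ |D|² ≥ (n+1) a, and dividing by (n+1)!
compares the two laws.

Fubini needs σ-finiteness; for general μ everything is moved to a σ-finite set carrying all the
functions. Domination of the point processes follows by pulling events back along `diracSum`. -/

/-! ### Algebra of antisymmetrization -/

/-- A function of `n` variables is antisymmetric if permuting its arguments multiplies it by the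
sign of the permutation. -/
def IsAntisymmetric {E : Type*} {n : ℕ} (f : (Fin n → E) → ℂ) : Prop :=
  ∀ (σ : Equiv.Perm (Fin n)) (x : Fin n → E), f (x ∘ σ) = ((Equiv.Perm.sign σ : ℤ) : ℂ) * f x

/-- The (unnormalized) antisymmetrization of a function of `n` variables. -/
noncomputable def antisymmetrization {E : Type*} {n : ℕ} (h : (Fin n → E) → ℂ) (y : Fin n → E) :
    ℂ :=
  ∑ σ : Equiv.Perm (Fin n), ((Equiv.Perm.sign σ : ℤ) : ℂ) * h (y ∘ σ)

/-- The Slater determinant `det (φᵢ(xⱼ))`. -/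
noncomputable def slater {E : Type*} {n : ℕ} (φ : Fin n → E → ℂ) (x : Fin n → E) : ℂ :=
  Matrix.det (Matrix.of fun i j => φ i (x j))

/-- The function `y ↦ u(y₀) f(y₁, …, yₙ)`. -/
def headTail {E : Type*} {n : ℕ} (u : E → ℂ) (f : (Fin n → E) → ℂ) (y : Fin (n + 1) → E) : ℂ :=
  u (y 0) * f (fun i => y i.succ)

theorem sign_mul_sign_complex {n : ℕ} (σ : Equiv.Perm (Fin n)) :
    ((Equiv.Perm.sign σ : ℤ) : ℂ) * ((Equiv.Perm.sign σ : ℤ) : ℂ) = 1 := by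
  rcases Int.units_eq_one_or (Equiv.Perm.sign σ) with h | h <;> simp [h]

theorem isAntisymmetric_slater {E : Type*} {n : ℕ} (φ : Fin n → E → ℂ) :
    IsAntisymmetric (slater φ) := fun σ x =>
  Matrix.det_permute' σ (Matrix.of fun i j => φ i (x j))

theorem IsAntisymmetric.indicator {E : Type*} {n : ℕ} {f : (Fin n → E) → ℂ}
    (hf : IsAntisymmetric f) {𝒜 : Set (Fin n → E)} (h𝒜 : IsSymmetricSet 𝒜) :
    IsAntisymmetric (𝒜.indicator f) := by
  intro σ x
  by_cases hx : x ∈ 𝒜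
  · rw [Set.indicator_of_mem hx, Set.indicator_of_mem (h𝒜 σ x hx), hf]
  · have : x ∘ σ ∉ 𝒜 := fun h => hx (by simpa [Function.comp_assoc] using h𝒜 σ⁻¹ _ h)
    rw [Set.indicator_of_notMem hx, Set.indicator_of_notMem this, mul_zero]

theorem isAntisymmetric_antisymmetrization {E : Type*} {n : ℕ} (h : (Fin n → E) → ℂ) :
    IsAntisymmetric (antisymmetrization h) := by
  intro τ x
  unfold antisymmetrization
  rw [Finset.mul_sum]
  refine Fintype.sum_equiv (Equiv.mulLeft τ) _ _ fun σ => ?_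
  have : (x ∘ ⇑(τ * σ)) = (x ∘ τ) ∘ σ := rfl
  simp only [Equiv.coe_mulLeft, this, Equiv.Perm.sign_mul, Units.val_mul, Int.cast_mul]
  rw [← mul_assoc, ← mul_assoc, sign_mul_sign_complex, one_mul]

/-- For antisymmetric `f`, the antisymmetrization of `u ⊗ f` only involves transpositions. -/
theorem antisymmetrization_headTail {E : Type*} {n : ℕ} (u : E → ℂ) {f : (Fin n → E) → ℂ}
    (hf : IsAntisymmetric f) (y : Fin (n + 1) → E) :
    antisymmetrization (headTail u f) y = n.factorial *
      (headTail u f y - ∑ j : Fin n, headTail u f (y ∘ Equiv.swap 0 j.succ)) := by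
  -- A permutation of n + 1 letters is a transposition (0 p) composed with a permutation e of the
  -- tail. Antisymmetry of f absorbs e together with its sign, so each p contributes n! equal terms.
  have key : ∀ (p : Fin (n + 1)) (e : Equiv.Perm (Fin n)),
      ((Equiv.Perm.sign (Equiv.Perm.decomposeFin.symm (p, e)) : ℤ) : ℂ) *
        headTail u f (y ∘ Equiv.Perm.decomposeFin.symm (p, e)) =
      (if p = 0 then 1 else -1) * headTail u f (y ∘ Equiv.swap 0 p) := by
    intro p e
    have h1 : (fun i : Fin n => (y ∘ Equiv.Perm.decomposeFin.symm (p, e)) i.succ) =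
        (fun i : Fin n => (y ∘ Equiv.swap 0 p) i.succ) ∘ e := by
      funext i; simp
    unfold headTail
    rw [h1, hf]
    simp only [Equiv.Perm.decomposeFin.symm_sign, Function.comp_apply,
      Equiv.Perm.decomposeFin_symm_apply_zero, Equiv.swap_apply_left]
    rcases Int.units_eq_one_or (Equiv.Perm.sign e) with h | h <;> split_ifs <;> simp [h]
  unfold antisymmetrization
  rw [← Equiv.sum_comp Equiv.Perm.decomposeFin.symm, Fintype.sum_prod_type]
  simp only [key, Finset.sum_const, Finset.card_univ, Fintype.card_perm, Fintype.card_fin,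
    nsmul_eq_mul, ← Finset.mul_sum]
  rw [Fin.sum_univ_succ]
  simp [Fin.succ_ne_zero, sub_eq_add_neg]

/-! ### Permutation invariance and inner products in L² -/

section Integrals

variable {E : Type*} [MeasurableSpace E] {ν : Measure E} [SigmaFinite ν]

theorem coe_piCongrLeft_inv {n : ℕ} (σ : Equiv.Perm (Fin n)) :
    ⇑(MeasurableEquiv.piCongrLeft (fun _ : Fin n => E) σ⁻¹) = fun x => x ∘ σ := by
  funext x i
  obtain ⟨k, rfl⟩ := σ⁻¹.surjective i
  rw [MeasurableEquiv.coe_piCongrLeft, Equiv.piCongrLeft_apply_apply]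
  simp

theorem measurePreserving_comp_perm {n : ℕ} (σ : Equiv.Perm (Fin n)) :
    MeasurePreserving (fun x : Fin n → E => x ∘ σ) (Measure.pi fun _ => ν)
      (Measure.pi fun _ => ν) := by
  have := measurePreserving_piCongrLeft (α := fun _ : Fin n => E) (fun _ => ν) σ⁻¹
  rwa [coe_piCongrLeft_inv] at this

theorem integral_comp_perm {n : ℕ} (σ : Equiv.Perm (Fin n)) (F : (Fin n → E) → ℂ) :
    ∫ x, F (x ∘ σ) ∂(Measure.pi fun _ => ν) = ∫ x, F x ∂(Measure.pi fun _ => ν) := by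
  have := MeasurePreserving.integral_comp'
    (measurePreserving_piCongrLeft (α := fun _ : Fin n => E) (fun _ => ν) σ⁻¹) F
  rwa [coe_piCongrLeft_inv] at this

theorem MemLp.comp_perm {n : ℕ} {h : (Fin n → E) → ℂ}
    (hh : MemLp h 2 (Measure.pi fun _ => ν)) (σ : Equiv.Perm (Fin n)) :
    MemLp (fun x => h (x ∘ σ)) 2 (Measure.pi fun _ => ν) :=
  hh.comp_measurePreserving (measurePreserving_comp_perm σ)

theorem memLp_antisymmetrization {n : ℕ} {h : (Fin n → E) → ℂ}
    (hh : MemLp h 2 (Measure.pi fun _ => ν)) :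
    MemLp (antisymmetrization h) 2 (Measure.pi fun _ => ν) :=
  memLp_finsetSum _ fun σ _ => (MemLp.comp_perm hh σ).const_mul _

theorem integrable_conj_mul {α : Type*} [MeasurableSpace α] {ρ : Measure α} {f g : α → ℂ}
    (hf : MemLp f 2 ρ) (hg : MemLp g 2 ρ) : Integrable (fun x => conj (f x) * g x) ρ :=
  MemLp.integrable_mul (p := 2) (q := 2) hf.star hg

/-- Each sign is absorbed by D, and the substitution y ↦ y ∘ σ preserves the product measure, so all
n! terms agree: antisymmetrization is n! times the orthogonal projection onto antisymmetric
functions. -/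
theorem integral_conj_antisymmetrization_mul {n : ℕ} {h D : (Fin n → E) → ℂ}
    (hh : MemLp h 2 (Measure.pi fun _ => ν)) (hD : MemLp D 2 (Measure.pi fun _ => ν))
    (hDa : IsAntisymmetric D) :
    ∫ y, conj (antisymmetrization h y) * D y ∂(Measure.pi fun _ => ν) =
      n.factorial * ∫ y, conj (h y) * D y ∂(Measure.pi fun _ => ν) := by
  have key : ∀ y, conj (antisymmetrization h y) * D y =
      ∑ σ : Equiv.Perm (Fin n), conj (h (y ∘ σ)) * D (y ∘ σ) := by
    intro y
    simp only [antisymmetrization, map_sum, map_mul, Finset.sum_mul, hDa _ y, map_intCast]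
    exact Finset.sum_congr rfl fun σ _ => by ring
  simp only [key]
  rw [integral_finsetSum _ fun σ _ =>
    integrable_conj_mul (MemLp.comp_perm hh σ) (MemLp.comp_perm hD σ)]
  have := fun σ : Equiv.Perm (Fin n) =>
    integral_comp_perm (ν := ν) σ (fun y => conj (h y) * D y)
  simp only [this]
  simp [Fintype.card_perm]

theorem integral_cons {n : ℕ} (F : E → (Fin n → E) → ℂ) :
    ∫ y, F (y 0) (fun i => y i.succ) ∂(Measure.pi fun _ : Fin (n + 1) => ν) =
      ∫ z, F z.1 z.2 ∂(ν.prod (Measure.pi fun _ : Fin n => ν)) :=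
  (measurePreserving_piFinSuccAbove (fun _ : Fin (n + 1) => ν) 0).integral_comp'
    (fun z : E × (Fin n → E) => F z.1 z.2)

theorem memLp_headTail {n : ℕ} {u : E → ℂ} {f : (Fin n → E) → ℂ} (hu : MemLp u 2 ν)
    (hf : MemLp f 2 (Measure.pi fun _ => ν)) :
    MemLp (headTail u f) 2 (Measure.pi fun _ => ν) := by
  have h : MemLp (fun z : E × (Fin n → E) => u z.1 * f z.2) 2
      (ν.prod (Measure.pi fun _ => ν)) := by
    refine (memLp_two_iff_integrable_sq_norm (hu.1.comp_fst.mul hf.1.comp_snd)).2 ?_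
    simp only [Pi.mul_apply, norm_mul, mul_pow]
    exact Integrable.mul_prod ((memLp_two_iff_integrable_sq_norm hu.1).1 hu)
      ((memLp_two_iff_integrable_sq_norm hf.1).1 hf)
  exact h.comp_measurePreserving (measurePreserving_piFinSuccAbove (fun _ : Fin (n + 1) => ν) 0)

theorem memLp_slater {n : ℕ} {φ : Fin n → E → ℂ} (hφ : ∀ k, MemLp (φ k) 2 ν) :
    MemLp (slater φ) 2 (Measure.pi fun _ => ν) := by
  unfold slater
  simp only [Matrix.det_apply', Matrix.of_apply]
  refine memLp_finsetSum _ fun σ _ => MemLp.const_mul ?_ _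
  have hm : AEStronglyMeasurable (fun x : Fin n → E => ∏ i, φ (σ i) (x i))
      (Measure.pi fun _ => ν) :=
    Finset.aestronglyMeasurable_fun_prod _ fun i _ =>
      (hφ _).1.comp_quasiMeasurePreserving (Measure.quasiMeasurePreserving_eval _ i)
  rw [memLp_two_iff_integrable_sq_norm hm]
  simp only [norm_prod, ← Finset.prod_pow]
  exact Integrable.fintype_prod (f := fun i x => ‖φ (σ i) x‖ ^ 2)
    fun i => (memLp_two_iff_integrable_sq_norm (hφ _).1).1 (hφ _)

/-- Exchanging a variable of `u` with a variable of `f` in `u ⊗ f` gives a function having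
non-negative inner product with `u ⊗ f`. -/
theorem re_integral_headTail_swap_nonneg {n : ℕ} {u : E → ℂ} {f : (Fin n → E) → ℂ}
    (hu : MemLp u 2 ν) (hf : MemLp f 2 (Measure.pi fun _ => ν)) (j : Fin n) :
    0 ≤ (∫ y, conj (headTail u f y) * headTail u f (y ∘ Equiv.swap 0 j.succ)
      ∂(Measure.pi fun _ => ν)).re := by
  obtain ⟨m, rfl⟩ : ∃ m, n = m + 1 := ⟨n - 1, by have := j.2; omega⟩
  set π := Measure.pi fun _ : Fin m => ν
  let e₁ := MeasurableEquiv.piFinSuccAbove (fun _ : Fin (m + 2) => E) 0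
  let e₂ := MeasurableEquiv.piFinSuccAbove (fun _ : Fin (m + 1) => E) j
  let e := (e₁.trans ((MeasurableEquiv.refl E).prodCongr e₂)).trans
    MeasurableEquiv.prodAssoc.symm
  have he : MeasurePreserving e (Measure.pi fun _ : Fin (m + 2) => ν) ((ν.prod ν).prod π) :=
    ((measurePreserving_piFinSuccAbove (fun _ : Fin (m + 2) => ν) 0).trans
      ((MeasurePreserving.id ν).prod
        (measurePreserving_piFinSuccAbove (fun _ : Fin (m + 1) => ν) j))).trans
      (measurePreserving_prodAssoc ν ν π).symm
  -- With s = y₀, t the exchanged variable and w the remaining ones, the four factors regroup into a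
  -- function of (s, w) times the conjugate of the same function at (t, w).
  let G : (E × E) × (Fin m → E) → ℂ := fun z =>
    (conj (u z.1.1) * f (j.insertNth z.1.1 z.2)) * (u z.1.2 * conj (f (j.insertNth z.1.2 z.2)))
  have hG : ∀ y, conj (headTail u f y) * headTail u f (y ∘ Equiv.swap 0 j.succ) = G (e y) := by
    intro y
    have h1 : (fun i : Fin (m + 1) => y i.succ) =
        j.insertNth (y j.succ) (fun i => y (j.succAbove i).succ) := by
      refine (Fin.insertNth_self_removeNth j _).symm
    have h2 : (fun i : Fin (m + 1) => y (Equiv.swap 0 j.succ i.succ)) =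
        j.insertNth (y 0) (fun i => y (j.succAbove i).succ) := by
      funext i
      refine Fin.succAboveCases j ?_ (fun k => ?_) i
      · simp
      · rw [Fin.insertNth_apply_succAbove, Equiv.swap_apply_of_ne_of_ne (Fin.succ_ne_zero _)
          (by simp)]
    have h3 : G (e y) = (conj (u (y 0)) * f (j.insertNth (y 0) fun i => y (j.succAbove i).succ)) *
        (u (y j.succ) * conj (f (j.insertNth (y j.succ) fun i => y (j.succAbove i).succ))) := rfl
    rw [h3]
    simp only [headTail, Function.comp_apply, Equiv.swap_apply_left, h1, h2, map_mul]
    ring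
  have hint : Integrable G ((ν.prod ν).prod π) := by
    rw [← he.integrable_comp_emb e.measurableEmbedding]
    have h := memLp_headTail hu hf
    exact (integrable_conj_mul h (MemLp.comp_perm h (Equiv.swap 0 j.succ))).congr
      (Filter.Eventually.of_forall hG)
  simp only [hG]
  rw [he.integral_comp' G, integral_prod_symm G hint]
  -- For fixed w the double integral factors as a number times its conjugate. `integral_prod_mul`
  -- asks for no integrability, so this holds for every w.
  have hin : ∀ w, ∫ z, G (z, w) ∂(ν.prod ν) =
      ((‖∫ s, conj (u s) * f (j.insertNth s w) ∂ν‖ ^ 2 : ℝ) : ℂ) := by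
    intro w
    have := integral_prod_mul (μ := ν) (ν := ν) (fun s => conj (u s) * f (j.insertNth s w))
      (fun s => u s * conj (f (j.insertNth s w)))
    simp only [G, this]
    have h2 : ∫ s, u s * conj (f (j.insertNth s w)) ∂ν =
        conj (∫ s, conj (u s) * f (j.insertNth s w) ∂ν) := by
      rw [← integral_conj]; simp
    rw [h2, Complex.mul_conj, Complex.normSq_eq_norm_sq]
  simp only [hin]
  rw [integral_complex_ofReal, Complex.ofReal_re]
  exact integral_nonneg fun w => by positivity

end Integrals

/-- Expansion of a Slater determinant along its first variable. -/
theorem slater_succ {E : Type*} {n : ℕ} (φ : Fin (n + 1) → E → ℂ) (y : Fin (n + 1) → E) :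
    slater φ y = ∑ i : Fin (n + 1), (-1) ^ (i : ℕ) *
      headTail (φ i) (slater fun k => φ (i.succAbove k)) y := by
  unfold slater
  rw [Matrix.det_succ_column_zero]
  refine Finset.sum_congr rfl fun i _ => ?_
  simp only [headTail, mul_assoc, Matrix.of_apply]
  rfl

/-! ### The σ-finite inequality -/

section Inequality

variable {E : Type*} [MeasurableSpace E] {ν : Measure E} [SigmaFinite ν]

theorem integral_conj_mul_self {α : Type*} [MeasurableSpace α] {ρ : Measure α} (f : α → ℂ) :
    ∫ x, conj (f x) * f x ∂ρ = ((∫ x, ‖f x‖ ^ 2 ∂ρ : ℝ) : ℂ) := by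
  rw [← integral_complex_ofReal]
  refine integral_congr_ae (Filter.Eventually.of_forall fun x => ?_)
  simp only [Complex.conj_mul']
  push_cast; rfl

/-- Antisymmetrizing `u ⊗ f` with `u` a unit vector increases the squared norm by a factor of at
most `(n + 1)! n!`. -/
theorem integral_norm_antisymmetrization_headTail_le {n : ℕ} {u : E → ℂ} {f : (Fin n → E) → ℂ}
    (hu : MemLp u 2 ν) (hu1 : ∫ t, conj (u t) * u t ∂ν = 1)
    (hf : MemLp f 2 (Measure.pi fun _ => ν)) (hfa : IsAntisymmetric f) :
    ∫ y, ‖antisymmetrization (headTail u f) y‖ ^ 2 ∂(Measure.pi fun _ => ν) ≤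
      ((n + 1).factorial : ℝ) * n.factorial * ∫ x, ‖f x‖ ^ 2 ∂(Measure.pi fun _ => ν) := by
  have hh := memLp_headTail hu hf
  -- Antisymmetrizing only one side costs (n+1)!; expanding the other side into transpositions in
  -- `h4` brings out the factor n!.
  have h1 := integral_conj_antisymmetrization_mul hh (memLp_antisymmetrization hh)
    (isAntisymmetric_antisymmetrization _)
  rw [integral_conj_mul_self] at h1
  have h2 : ∫ y, conj (headTail u f y) * headTail u f y ∂(Measure.pi fun _ => ν) =
      ((∫ x, ‖f x‖ ^ 2 ∂(Measure.pi fun _ => ν) : ℝ) : ℂ) := by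
    have h3 := integral_cons (ν := ν) (n := n) fun t x => (conj (u t) * u t) * (conj (f x) * f x)
    rw [integral_prod_mul (fun t => conj (u t) * u t) (fun x => conj (f x) * f x), hu1, one_mul,
      integral_conj_mul_self] at h3
    rw [← h3]
    refine integral_congr_ae (Filter.Eventually.of_forall fun y => ?_)
    simp only [headTail, map_mul]
    ring
  have h4 : ∫ y, conj (headTail u f y) * antisymmetrization (headTail u f) y
      ∂(Measure.pi fun _ => ν) = n.factorial *
        (((∫ x, ‖f x‖ ^ 2 ∂(Measure.pi fun _ => ν) : ℝ) : ℂ) - ∑ j : Fin n,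
          ∫ y, conj (headTail u f y) * headTail u f (y ∘ Equiv.swap 0 j.succ)
            ∂(Measure.pi fun _ => ν)) := by
    have hint := fun j : Fin n =>
      integrable_conj_mul hh (MemLp.comp_perm hh (Equiv.swap 0 j.succ))
    rw [← h2, ← integral_finsetSum _ fun j _ => hint j,
      ← integral_sub (integrable_conj_mul hh hh) (integrable_finsetSum _ fun j _ => hint j),
      ← integral_const_mul]
    refine integral_congr_ae (Filter.Eventually.of_forall fun y => ?_)
    simp only [antisymmetrization_headTail u hfa, ← Finset.mul_sum]
    ring
  have h5 := congrArg Complex.re (h1.trans (congrArg _ h4))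
  have h6 : 0 ≤ ∑ j : Fin n, (∫ y, conj (headTail u f y) *
      headTail u f (y ∘ Equiv.swap 0 j.succ) ∂(Measure.pi fun _ => ν)).re :=
    Finset.sum_nonneg fun j _ => re_integral_headTail_swap_nonneg hu hf j
  rw [← Complex.ofReal_natCast, ← Complex.ofReal_natCast, Complex.re_ofReal_mul,
    Complex.re_ofReal_mul, Complex.sub_re, Complex.re_sum, Complex.ofReal_re,
    Complex.ofReal_re] at h5
  rw [h5, mul_assoc]
  gcongr
  linarith

/-- In the expansion of the determinant along its first variable, orthogonality kills every term but
the one with the last function, whose cofactor has sign (-1)ⁿ. -/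
theorem integral_conj_headTail_mul_slater {n : ℕ} {φ : Fin (n + 1) → E → ℂ}
    (hφ : ∀ k, MemLp (φ k) 2 ν)
    (horth : ∀ k, ∫ t, conj (φ (Fin.last n) t) * φ k t ∂ν = if k = Fin.last n then 1 else 0)
    {f : (Fin n → E) → ℂ} (hf : MemLp f 2 (Measure.pi fun _ => ν)) :
    ∫ y, conj (headTail (φ (Fin.last n)) f y) * slater φ y ∂(Measure.pi fun _ => ν) =
      (-1) ^ n * ∫ x, conj (f x) * slater (fun k => φ k.castSucc) x ∂(Measure.pi fun _ => ν) := by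
  have h1 : ∀ i, ∫ y, conj (headTail (φ (Fin.last n)) f y) *
      headTail (φ i) (slater fun k => φ (i.succAbove k)) y ∂(Measure.pi fun _ => ν) =
      (if i = Fin.last n then 1 else 0) *
        ∫ x, conj (f x) * slater (fun k => φ (i.succAbove k)) x ∂(Measure.pi fun _ => ν) := by
    intro i
    have h3 := integral_cons (ν := ν) (n := n) fun t x =>
      (conj (φ (Fin.last n) t) * φ i t) * (conj (f x) * slater (fun k => φ (i.succAbove k)) x)
    rw [integral_prod_mul (fun t => conj (φ (Fin.last n) t) * φ i t)
      (fun x => conj (f x) * slater (fun k => φ (i.succAbove k)) x), horth] at h3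
    rw [← h3]
    refine integral_congr_ae (Filter.Eventually.of_forall fun y => ?_)
    simp only [headTail, map_mul]
    ring
  simp only [slater_succ φ, Finset.mul_sum, mul_left_comm _ ((-1 : ℂ) ^ _)]
  rw [integral_finsetSum _ fun i _ => (integrable_conj_mul (memLp_headTail (hφ _) hf)
    (memLp_headTail (hφ _) (memLp_slater fun k => hφ _))).const_mul _]
  simp only [integral_const_mul, h1]
  simp

/-- The squared norm of the part of an `n`-fold wedge product supported on `𝒜` is dominated by
that of the `(n + 1)`-fold wedge product on `ℬ`. -/
theorem integral_norm_slater_le {n : ℕ} {φ : Fin (n + 1) → E → ℂ}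
    (hφ : ∀ k, MemLp (φ k) 2 ν)
    (horth : ∀ k, ∫ t, conj (φ (Fin.last n) t) * φ k t ∂ν = if k = Fin.last n then 1 else 0)
    {𝒜 : Set (Fin n → E)} {ℬ : Set (Fin (n + 1) → E)} (hA : MeasurableSet 𝒜)
    (hB : MeasurableSet ℬ) (hAs : IsSymmetricSet 𝒜) (hBs : IsSymmetricSet ℬ)
    (hAB : ∀ y : Fin (n + 1) → E, (fun i => y i.succ) ∈ 𝒜 → y ∈ ℬ) :
    (n + 1) * ∫ x in 𝒜, ‖slater (fun k => φ k.castSucc) x‖ ^ 2 ∂(Measure.pi fun _ => ν) ≤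
      ∫ y in ℬ, ‖slater φ y‖ ^ 2 ∂(Measure.pi fun _ => ν) := by
  set ψ := slater fun k => φ k.castSucc with hψ
  set u := φ (Fin.last n) with hu
  have hψm : MemLp ψ 2 (Measure.pi fun _ => ν) := memLp_slater fun k => hφ _
  have hDm := memLp_slater hφ
  set f := 𝒜.indicator ψ with hfdef
  have hf : MemLp f 2 (Measure.pi fun _ => ν) := hψm.indicator hA
  have hfa : IsAntisymmetric f := (isAntisymmetric_slater _).indicator hAs
  set g := antisymmetrization (headTail u f) with hg
  have hgm : MemLp g 2 (Measure.pi fun _ => ν) := memLp_antisymmetrization (memLp_headTail (hφ _) hf)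
  -- If some rearrangement of y had its tail in 𝒜, it would lie in ℬ, and then so would y by
  -- symmetry.
  have hgB : ∀ y ∉ ℬ, g y = 0 := by
    intro y hy
    refine Finset.sum_eq_zero fun σ _ => ?_
    have : (fun i : Fin n => (y ∘ σ) i.succ) ∉ 𝒜 := fun h => hy (by
      simpa [Function.comp_assoc] using hBs σ⁻¹ _ (hAB _ h))
    simp only [headTail, hfdef, Set.indicator_of_notMem this, mul_zero]
  have ha : ∫ x, ‖f x‖ ^ 2 ∂(Measure.pi fun _ => ν) =
      ∫ x in 𝒜, ‖ψ x‖ ^ 2 ∂(Measure.pi fun _ => ν) := by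
    rw [← integral_indicator hA]
    refine integral_congr_ae (Filter.Eventually.of_forall fun x => ?_)
    by_cases hx : x ∈ 𝒜 <;> simp [hfdef, hx]
  rw [← ha]
  set a := ∫ x, ‖f x‖ ^ 2 ∂(Measure.pi fun _ => ν)
  have hgnorm : ∫ y, ‖g y‖ ^ 2 ∂(Measure.pi fun _ => ν) ≤
      ((n + 1).factorial : ℝ) * n.factorial * a :=
    integral_norm_antisymmetrization_headTail_le (hφ _) (by simpa using horth (Fin.last n)) hf hfa
  have hgD : ∫ y, conj (g y) * slater φ y ∂(Measure.pi fun _ => ν) =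
      (n + 1).factorial * ((-1) ^ n * (a : ℂ)) := by
    rw [integral_conj_antisymmetrization_mul (memLp_headTail (hφ _) hf) hDm
      (isAntisymmetric_slater φ), integral_conj_headTail_mul_slater hφ horth hf,
      ← integral_conj_mul_self f]
    congr 2
    refine integral_congr_ae (Filter.Eventually.of_forall fun x => ?_)
    by_cases hx : x ∈ 𝒜 <;> simp [hfdef, hx, hψ]
  -- This is ⟨g, D⟩ divided by the upper bound for ‖g‖², the best coefficient in |D - c g|² ≥ 0.
  -- Using that square in place of Cauchy–Schwarz avoids dividing by a, which may be 0.
  set c : ℝ := (-1) ^ n / n.factorial with hc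
  have hpt : ∀ y, 2 * c * (conj (g y) * slater φ y).re - c ^ 2 * ‖g y‖ ^ 2 ≤
      ℬ.indicator (fun y => ‖slater φ y‖ ^ 2) y := by
    intro y
    by_cases hy : y ∈ ℬ
    · rw [Set.indicator_of_mem hy, ← Complex.normSq_eq_norm_sq, ← Complex.normSq_eq_norm_sq,
        Complex.normSq_apply, Complex.normSq_apply, Complex.mul_re, Complex.conj_re,
        Complex.conj_im]
      nlinarith [sq_nonneg ((slater φ y).re - c * (g y).re),
        sq_nonneg ((slater φ y).im - c * (g y).im)]
    · rw [Set.indicator_of_notMem hy, hgB y hy]; simp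
  have hi1 := integrable_conj_mul hgm hDm
  have hi1re : Integrable (fun y => (conj (g y) * slater φ y).re) (Measure.pi fun _ => ν) := hi1.re
  have hi2 := (memLp_two_iff_integrable_sq_norm hgm.1).1 hgm
  have hi3 := (memLp_two_iff_integrable_sq_norm hDm.1).1 hDm
  have hmono := integral_mono ((hi1re.const_mul (2 * c)).sub (hi2.const_mul (c ^ 2)))
    (hi3.indicator hB) hpt
  have hre : ∫ y, (conj (g y) * slater φ y).re ∂(Measure.pi fun _ => ν) =
      (n + 1).factorial * ((-1) ^ n * a) := by
    have := congrArg Complex.re hgD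
    rw [show (((n + 1).factorial : ℂ) * ((-1) ^ n * (a : ℂ))) =
      (((n + 1).factorial * ((-1) ^ n * a) : ℝ) : ℂ) by push_cast; rfl, Complex.ofReal_re] at this
    rw [← this]
    exact integral_re hi1
  rw [integral_indicator hB] at hmono
  refine le_trans ?_ hmono
  have hsub : ∫ y, (2 * c * (conj (g y) * slater φ y).re - c ^ 2 * ‖g y‖ ^ 2)
      ∂(Measure.pi fun _ => ν) = 2 * c * ((n + 1).factorial * ((-1) ^ n * a)) -
        c ^ 2 * ∫ y, ‖g y‖ ^ 2 ∂(Measure.pi fun _ => ν) := by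
    rw [integral_sub (hi1re.const_mul (2 * c)) (hi2.const_mul (c ^ 2)), integral_const_mul,
      integral_const_mul, ← hre]
  refine le_trans ?_ hsub.ge
  have hfac : (n.factorial : ℝ) ≠ 0 := by positivity
  have hsq : ((-1 : ℝ) ^ n) * (-1) ^ n = 1 := by rw [← mul_pow]; simp
  have hc1 : 2 * c * ((n + 1).factorial * ((-1) ^ n * a)) = 2 * ((n + 1) * a) := by
    rw [hc, Nat.factorial_succ]
    push_cast
    field_simp
    linear_combination a * hsq
  have hc2 : c ^ 2 * (((n + 1).factorial : ℝ) * n.factorial * a) = (n + 1) * a := by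
    rw [hc, Nat.factorial_succ]
    push_cast
    field_simp
    linear_combination a * hsq
  have := mul_le_mul_of_nonneg_left hgnorm (sq_nonneg c)
  rw [hc1]
  linarith

end Inequality

theorem TupleSetLE.mem_of_tail_mem {E : Type*} {n : ℕ} {𝒜 : Set (Fin n → E)} {ℬ : Set (Fin (n + 1) → E)}
    (h : TupleSetLE 𝒜 ℬ) (hℬ : IsSymmetricSet ℬ) (y : Fin (n + 1) → E)
    (hy : (fun i : Fin n => y i.succ) ∈ 𝒜) : y ∈ ℬ := by
  -- `TupleSetLE` appends the new point at the end; a cyclic rotation brings it to the front.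
  have h1 := hℬ (finRotate (n + 1))⁻¹ _ (h _ hy (y 0))
  convert h1 using 1
  funext i
  obtain ⟨k, rfl⟩ := (finRotate (n + 1)).surjective i
  rw [Function.comp_apply, Equiv.Perm.inv_def, Equiv.symm_apply_apply]
  refine Fin.lastCases ?_ (fun k => ?_) k
  · rw [finRotate_last, Fin.snoc_last]
  · rw [finRotate_apply, Fin.coeSucc_eq_succ, Fin.snoc_castSucc]

theorem det_projectionKernel {E : Type*} {n : ℕ} (φ : Fin n → E → ℂ) (x : Fin n → E) :
    (Matrix.of fun i j => projectionKernel φ (x i) (x j)).det = ((‖slater φ x‖ ^ 2 : ℝ) : ℂ) := by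
  have : (Matrix.of fun i j => projectionKernel φ (x i) (x j)) =
      (Matrix.of fun i j => φ i (x j)).transpose *
        (Matrix.of fun i j => φ i (x j)).map (starRingEnd ℂ) := by
    ext i j
    simp [Matrix.mul_apply, projectionKernel]
  rw [this, Matrix.det_mul, Matrix.det_transpose, ← RingHom.mapMatrix_apply, ← RingHom.map_det,
    Complex.mul_conj, Complex.normSq_eq_norm_sq]
  rfl

/-! ### Reduction from arbitrary to σ-finite measures -/

section Reduction

variable {E : Type*} [MeasurableSpace E]

/-- Only the upper bound of the Carathéodory product on boxes is used, so σ-finiteness is not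
needed; a zero factor beats infinite ones. -/
theorem pi_eval_preimage_null_of_null {μ : Measure E} {n : ℕ} {s : Set E} (hs : μ s = 0)
    (i : Fin n) : (Measure.pi fun _ : Fin n => μ) (Function.eval i ⁻¹' s) = 0 := by
  obtain ⟨t, hst, ht, hμt⟩ := exists_measurable_superset_of_null hs
  refine measure_mono_null (Set.preimage_mono hst) ?_
  rw [← Set.univ_pi_update_univ, Measure.pi, toMeasure_apply _ _ (MeasurableSet.univ_pi fun j => by
    by_cases h : j = i
    · subst h; simpa using ht
    · simp [h])]
  refine le_antisymm ((OuterMeasure.pi_pi_le _ _).trans_eq ?_) (zero_le)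
  exact Finset.prod_eq_zero (Finset.mem_univ i) (by simp [hμt])

/-- The restriction of a (not necessarily σ-finite) product measure to a σ-finite box. -/
theorem pi_restrict_of_sigmaFinite_restrict {μ : Measure E} {t : Set E} (ht : MeasurableSet t)
    [SigmaFinite (μ.restrict t)] (n : ℕ) :
    (Measure.pi fun _ : Fin n => μ).restrict (Set.univ.pi fun _ => t) =
      Measure.pi fun _ : Fin n => μ.restrict t := by
  symm
  refine Measure.pi_eq fun s hs => ?_
  have hms : MeasurableSet (Set.univ.pi s) := MeasurableSet.univ_pi hs
  have hmt : MeasurableSet (Set.univ.pi fun i => s i ∩ t) :=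
    MeasurableSet.univ_pi fun i => (hs i).inter ht
  rw [Measure.restrict_apply hms, ← Set.pi_inter_distrib]
  simp only [fun i => Measure.restrict_apply (μ := μ) (s := t) (hs i)]
  refine le_antisymm ?_ ?_
  · rw [Measure.pi, toMeasure_apply _ _ hmt]
    exact OuterMeasure.pi_pi_le _ _
  -- The Carathéodory product is the largest outer measure bounded on boxes by the product of the
  -- sides, so it dominates the product of the restrictions.
  · have hle : (Measure.pi fun _ : Fin n => μ.restrict t).toOuterMeasure ≤
        OuterMeasure.pi fun _ : Fin n => μ.toOuterMeasure := by
      refine OuterMeasure.le_pi.2 fun r _ => ?_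
      change (Measure.pi fun _ : Fin n => μ.restrict t) _ ≤ _
      rw [Measure.pi_pi]
      exact Finset.prod_le_prod' fun i _ => Measure.restrict_apply_le _ _
    have h1 := hle (Set.univ.pi fun i => s i ∩ t)
    change (Measure.pi fun _ : Fin n => μ.restrict t) _ ≤ _ at h1
    rw [Measure.pi_pi] at h1
    rw [Measure.pi, toMeasure_apply _ _ hmt]
    refine le_trans (le_of_eq ?_) h1
    refine Finset.prod_congr rfl fun i _ => ?_
    rw [Measure.restrict_apply ((hs i).inter ht), Set.inter_assoc, Set.inter_self]

/-- Almost everywhere, a tuple with a coordinate outside t gives the determinant a zero column, so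
the density lives on the box tⁿ. -/
theorem tupleLaw_apply_eq {μ : Measure E} {n : ℕ} {φ : Fin n → E → ℂ}
    (hφ : ∀ k, MemLp (φ k) 2 μ) {t : Set E} (ht : MeasurableSet t) [SigmaFinite (μ.restrict t)]
    (h0 : ∀ k, φ k =ᵐ[μ.restrict tᶜ] 0) {𝒜 : Set (Fin n → E)} (hA : MeasurableSet 𝒜) :
    tupleLaw μ φ 𝒜 = ENNReal.ofReal ((1 / (n.factorial : ℝ)) *
      ∫ x in 𝒜, ‖slater φ x‖ ^ 2 ∂(Measure.pi fun _ => μ.restrict t)) := by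
  set T : Set (Fin n → E) := Set.univ.pi fun _ => t
  have hT : MeasurableSet T := MeasurableSet.univ_pi fun _ => ht
  set F : (Fin n → E) → ENNReal :=
    fun x => ENNReal.ofReal ((1 / (n.factorial : ℝ)) * ‖slater φ x‖ ^ 2) with hF
  have h1 : tupleLaw μ φ 𝒜 = ∫⁻ x in 𝒜, F x ∂(Measure.pi fun _ => μ) := withDensity_apply _ hA
  have hae : ∀ᵐ x ∂(Measure.pi fun _ : Fin n => μ), ∀ i k, x i ∈ tᶜ → φ k (x i) = 0 := by
    rw [ae_all_iff]
    intro i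
    have hN := ae_all_iff.2 fun k => (ae_restrict_iff' ht.compl).1 (h0 k)
    rw [ae_iff]
    exact pi_eval_preimage_null_of_null (ae_iff.1 hN) i
  have hzero : ∫⁻ x in Tᶜ, F x ∂((Measure.pi fun _ => μ).restrict 𝒜) = 0 := by
    refine (setLIntegral_congr_fun_ae hT.compl ?_).trans (lintegral_zero)
    refine (ae_restrict_of_ae hae).mono fun x hx hxT => ?_
    obtain ⟨i, hi⟩ : ∃ i, x i ∉ t := by
      simpa [T] using hxT
    have : slater φ x = 0 := Matrix.det_eq_zero_of_column_eq_zero i fun k => hx i k hi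
    simp [hF, this]
  rw [h1, ← lintegral_add_compl F hT, hzero, add_zero, Measure.restrict_restrict hT, Set.inter_comm,
    ← Measure.restrict_restrict hA, pi_restrict_of_sigmaFinite_restrict ht, ← integral_const_mul]
  have hi := memLp_slater (ν := μ.restrict t) fun k => (hφ k).restrict t
  exact (ofReal_integral_eq_lintegral_ofReal
    ((((memLp_two_iff_integrable_sq_norm hi.1).1 hi).restrict).const_mul _)
    (Filter.Eventually.of_forall fun x => by positivity)).symm

/-- Finitely many square-integrable functions live on a common σ-finite set. -/
theorem exists_sigmaFinite_support {μ : Measure E} {n : ℕ} {φ : Fin n → E → ℂ}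
    (hφ : ∀ k, MemLp (φ k) 2 μ) :
    ∃ t, MeasurableSet t ∧ SigmaFinite (μ.restrict t) ∧ ∀ k, φ k =ᵐ[μ.restrict tᶜ] 0 := by
  -- Where the sum of the norms vanishes, every summand does, so one set serves all k.
  have hs : MemLp (fun x => ∑ k, ‖φ k x‖) 2 μ := memLp_finsetSum _ fun k _ => (hφ k).norm
  obtain ⟨t, ht, h0, hσ⟩ :=
    (hs.aefinStronglyMeasurable (by simp) (by simp)).exists_set_sigmaFinite
  refine ⟨t, ht, hσ, fun k => h0.mono fun x hx => ?_⟩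
  have := (Finset.sum_eq_zero_iff_of_nonneg fun k _ => norm_nonneg (φ k x)).1 hx k
    (Finset.mem_univ k)
  simpa using this

theorem integral_conj_mul_of_orthonormal {μ : Measure E} {ι : Type*} [DecidableEq ι]
    {φ : ι → E → ℂ} (hφ : ∀ k, MemLp (φ k) 2 μ)
    (horth : Orthonormal ℂ fun k => (hφ k).toLp (φ k)) (i j : ι) :
    ∫ x, conj (φ i x) * φ j x ∂μ = if i = j then 1 else 0 := by
  rw [← orthonormal_iff_ite.1 horth i j, L2.inner_def]
  refine integral_congr_ae ?_
  filter_upwards [(hφ i).coeFn_toLp, (hφ j).coeFn_toLp] with x hi hj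
  rw [hi, hj, RCLike.inner_apply, mul_comm]

/-- Monotonicity of the laws `tupleLaw` under adding a point. -/
theorem tupleLaw_le_tupleLaw_succ {μ : Measure E} {n : ℕ} {φ : Fin (n + 1) → E → ℂ}
    (hφ : ∀ k, MemLp (φ k) 2 μ) (horth : Orthonormal ℂ fun k => (hφ k).toLp (φ k))
    {𝒜 : Set (Fin n → E)} {ℬ : Set (Fin (n + 1) → E)} (hA : MeasurableSet 𝒜)
    (hB : MeasurableSet ℬ) (hAs : IsSymmetricSet 𝒜) (hBs : IsSymmetricSet ℬ)
    (hAB : TupleSetLE 𝒜 ℬ) :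
    tupleLaw μ (fun k : Fin n => φ k.castSucc) 𝒜 ≤ tupleLaw μ φ ℬ := by
  obtain ⟨t, ht, hσ, h0⟩ := exists_sigmaFinite_support hφ
  rw [tupleLaw_apply_eq (fun k => hφ _) ht (fun k => h0 _) hA, tupleLaw_apply_eq hφ ht h0 hB]
  have horth' : ∀ k, ∫ x, conj (φ (Fin.last n) x) * φ k x ∂(μ.restrict t) =
      if k = Fin.last n then 1 else 0 := by
    intro k
    simp only [eq_comm (a := k)]
    rw [← integral_conj_mul_of_orthonormal hφ horth]
    refine setIntegral_eq_integral_of_ae_compl_eq_zero ?_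
    filter_upwards [(ae_restrict_iff' ht.compl).1 (h0 k)] with x hx hxt
    simp [hx hxt]
  have key := integral_norm_slater_le (fun k => (hφ k).restrict t) horth' hA hB hAs hBs
    fun y hy => hAB.mem_of_tail_mem hBs y hy
  refine ENNReal.ofReal_le_ofReal ?_
  rw [Nat.factorial_succ]
  push_cast
  calc _ = 1 / (((n : ℝ) + 1) * n.factorial) * ((n + 1) * ∫ x in 𝒜,
          ‖slater (fun k : Fin n => φ k.castSucc) x‖ ^ 2 ∂(Measure.pi fun _ => μ.restrict t)) := by
        field_simp
    _ ≤ _ := by gcongr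

theorem kernelTupleLaw_projectionKernel (μ : Measure E) {n : ℕ} (φ : Fin n → E → ℂ) :
    kernelTupleLaw μ n (projectionKernel φ) = tupleLaw μ φ := by
  unfold kernelTupleLaw tupleLaw
  simp only [det_projectionKernel, Complex.ofReal_re]
  rfl

theorem diracSum_comp_perm {n : ℕ} (x : Fin n → E) (σ : Equiv.Perm (Fin n)) :
    diracSum (x ∘ σ) = diracSum x :=
  Subtype.ext (Equiv.sum_comp σ fun i => Measure.dirac (x i))

theorem diracSum_le_diracSum_snoc {n : ℕ} (x : Fin n → E) (t : E) :
    diracSum x ≤ diracSum (Fin.snoc x t : Fin (n + 1) → E) := by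
  change ∑ i, Measure.dirac (x i) ≤
    ∑ i, Measure.dirac ((Fin.snoc x t : Fin (n + 1) → E) i)
  rw [Fin.sum_univ_castSucc]
  simp only [Fin.snoc_castSucc]
  exact Measure.le_add_right le_rfl

end Reduction

/-! ### The theorem -/

theorem mainTheorem1 {E Ω₁ Ω₂ : Type*} [MeasurableSpace E] [MeasurableSpace Ω₁]
    [MeasurableSpace Ω₂] (μ : Measure E) (P : Measure Ω₁) [IsProbabilityMeasure P]
    (Q : Measure Ω₂) [IsProbabilityMeasure Q] (n : ℕ) (φ : Fin (n + 1) → E → ℂ)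
    (hφ : ∀ k, MemLp (φ k) 2 μ)
    (horth : Orthonormal ℂ fun k => (hφ k).toLp (φ k)) :
    (∀ (𝒳 : Ω₁ → PointConfiguration E) (𝒴 : Ω₂ → PointConfiguration E),
      IsDeterminantalProcess μ n (projectionKernel fun k : Fin n => φ k.castSucc) 𝒳 P →
      IsDeterminantalProcess μ (n + 1) (projectionKernel φ) 𝒴 Q →
      StochasticallyDominated 𝒳 P 𝒴 Q) ∧
    (∀ (X : Ω₁ → Fin n → E) (Y : Ω₂ → Fin (n + 1) → E),
      HasLaw X (tupleLaw μ fun k : Fin n => φ k.castSucc) P →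
      HasLaw Y (tupleLaw μ φ) Q →
      ∀ (𝒜 : Set (Fin n → E)) (ℬ : Set (Fin (n + 1) → E)),
        MeasurableSet 𝒜 → MeasurableSet ℬ → IsSymmetricSet 𝒜 → IsSymmetricSet ℬ →
        TupleSetLE 𝒜 ℬ → P (X ⁻¹' 𝒜) ≤ Q (Y ⁻¹' ℬ)) := by
  refine ⟨fun 𝒳 𝒴 h𝒳 h𝒴 𝒜 hA hup => ?_, fun X Y hX hY 𝒜 ℬ hA hB hAs hBs hAB => ?_⟩
  · rw [← Measure.map_apply_of_aemeasurable h𝒳.aemeasurable hA, h𝒳.map_eq,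
      ← Measure.map_apply_of_aemeasurable h𝒴.aemeasurable hA, h𝒴.map_eq,
      Measure.map_apply measurable_diracSum hA, Measure.map_apply measurable_diracSum hA,
      kernelTupleLaw_projectionKernel, kernelTupleLaw_projectionKernel]
    -- Both preimages of 𝒜 are symmetric because a configuration forgets order, and they are related
    -- by `TupleSetLE` because adding a point enlarges the configuration.
    refine tupleLaw_le_tupleLaw_succ hφ horth (measurable_diracSum hA) (measurable_diracSum hA)
      (fun σ x hx => ?_) (fun σ x hx => ?_) fun x hx t => hup (diracSum_le_diracSum_snoc x t) hx
    · simpa only [Set.mem_preimage, diracSum_comp_perm] using hx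
    · simpa only [Set.mem_preimage, diracSum_comp_perm] using hx
  · rw [← Measure.map_apply_of_aemeasurable hX.aemeasurable hA, hX.map_eq,
      ← Measure.map_apply_of_aemeasurable hY.aemeasurable hB, hY.map_eq]
    exact tupleLaw_le_tupleLaw_succ hφ horth hA hB hAs hBs hAB
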